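/- A system $(X,T)$ is a compact metric space $(X,\rho)$ with a homeomorphism $T\colon X\to X$; it is countable if $X$ is a countable set. For ordinals define the derived sets by $X^{(0)}=X$, $X^{(\beta+1)}=$ the set of accumulation points of $X^{(\beta)}$, and $X^{(\lambda)}=\bigcap_{\beta<\lambda}X^{(\beta)}$ for $\lambda$ a limit. Write $d(X)=\alpha$ if $X^{(\alpha)}\ne\emptyset$ and $X^{(\alpha+1)}=\emptyset$. For a closed set $A\subseteq X$ with $T(A)=A$ let $\Omega(A,T)$ be the set of $x\in A$ such that for every neighbourhood $U$ of $x$ in $A$ there is $k\ge1$ with $U\cap T^{-k}U\neq\emptyset$, and let $\Omega^{(\infty)}(A,T)$ be the set of $x\in A$ such that for every neighbourhood $U$ of $x$ in $A$ and every $m\ge1$ there is $k\ge1$ with $U\cap T^{-k}U\cap T^{-2k}U\cap\dots\cap T^{-mk}U\ne\emptyset$. Put $\Omega_0(X,T)=X$, $\Omega_{\beta+1}(X,T)=\Omega(\Omega_\beta(X,T),T)$ and $\Omega_\lambda(X,T)=\bigcap_{\beta<\lambda}\Omega_\beta(X,T)$ for $\lambda$ a limit, and let $\mathrm{depth}(X,T)$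 be the least $\beta$ with $\Omega_\beta(X,T)=\Omega_{\beta+1}(X,T)$. Define $\Omega^{(\infty)}_\beta(X,T)$ and $\mathrm{depth}^{(\infty)}(X,T)$ (the van der Waerden depth) in the same way, with $\Omega^{(\infty)}$ in place of $\Omega$. For $\delta>0$ let $\Gamma_\delta[x]=\{y\in X: \rho(T^kx,T^ky)\le\delta\ \text{for all } k\in\mathbb Z\}$. The system is $n$-expansive if for some $\delta>0$ every $\Gamma_\delta[x]$ has at most $n$ elements. It is essentially $n$-expansive if it is $n$-expansive and for every sufficiently small $\delta>0$ there is an $x$ such that $\Gamma_\delta[x]$ has exactly $n$ elements (for $n\ge 2$, equivalently: it is $n$-expansive but not $(n-1)$-expansive). **Theorem.** Let $\alpha\ge 2$ be a countable ordinal that is not a limit ordinal and let $n\ge2$ be an integer. Then there is a countable system $(X_\alpha,T_\alpha)$ such that 1. $d(X_\alpha)=\mathrm{depth}^{(\infty)}(X_\alpha,T_\alpha)=\mathrm{depth}(X_\alpha,T_\alpha)=\alpha$, and 2. $(X_\alpha,T_\alpha)$ is essentially $n$-expansive. -/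

import Mathlib

open Set Topology Ordinal

/-- Transfinite iteration of an operator `F` on subsets of `X`, starting from the whole space:
`F_0 = X`, `F_{α+1} = F (F_α)`, and `F_λ = ⋂_{α<λ} F_α` for a limit ordinal `λ`. -/
noncomputable def transIter {X : Type} (F : Set X → Set X) (α : Ordinal.{0}) : Set X :=
  Ordinal.limitRecOn α Set.univ (fun _ A => F A) (fun o _ ih => ⋂ (β : Ordinal.{0}) (h : β < o), ih β h)

theorem transIter_zero {X : Type} (F : Set X → Set X) : transIter F 0 = Set.univ := by
  simp [transIter]

theorem transIter_add_one {X : Type} (F : Set X → Set X) (α : Ordinal.{0}) :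
    transIter F (α + 1) = F (transIter F α) := by
  simp [transIter]

theorem transIter_limit {X : Type} (F : Set X → Set X) (o : Ordinal.{0})
    (ho : Order.IsSuccLimit o) :
    transIter F o = ⋂ (β : Ordinal.{0}) (_ : β < o), transIter F β := by
  unfold transIter
  rw [Ordinal.limitRecOn_limit _ _ _ _ ho]

/-- The derived set `X^{(α)}` of order `α`. All the sets `X^{(α)}` are closed when `X` is metric, so that
the accumulation points of `X^{(α)}` in `X` are its accumulation points as a subspace. -/
noncomputable def derivedSetOrd (X : Type) [TopologicalSpace X] (α : Ordinal.{0}) : Set X :=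
  transIter derivedSet α

/-- `d(X) = α`: the derived degree of `X` is `α`. -/
def HasDerivedDegree (X : Type) [TopologicalSpace X] (α : Ordinal.{0}) : Prop :=
  (derivedSetOrd X α).Nonempty ∧ derivedSetOrd X (α + 1) = ∅

/-- The set `Ω(A, T)` of non-wandering points of the subsystem of `(X, T)` on `A`;
the neighbourhoods of `x` in the subspace `A` are, up to enlarging them, the sets `U ∩ A`. -/
def nonwanderingIn {X : Type} [TopologicalSpace X] (T : X → X) (A : Set X) : Set X :=
  {x ∈ A | ∀ U ∈ 𝓝 x, ∃ k : ℕ, 1 ≤ k ∧ ((U ∩ A) ∩ T^[k] ⁻¹' (U ∩ A)).Nonempty}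

/-- The set `Ω^{(∞)}(A, T)` of multi-non-wandering points of the subsystem of `(X, T)` on `A`. -/
def multiNonwanderingIn {X : Type} [TopologicalSpace X] (T : X → X) (A : Set X) : Set X :=
  {x ∈ A | ∀ U ∈ 𝓝 x, ∀ d : ℕ, 1 ≤ d → ∃ k : ℕ, 1 ≤ k ∧
    (⋂ j ∈ Finset.range (d + 1), T^[j * k] ⁻¹' (U ∩ A)).Nonempty}

/-- `depth(X, T) = α`: `α` is the least ordinal with `Ω_α(X, T) = Ω_{α+1}(X, T)`. -/
def HasDepth {X : Type} [TopologicalSpace X] (T : X → X) (α : Ordinal.{0}) : Prop :=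
  IsLeast {β : Ordinal.{0} |
    transIter (nonwanderingIn T) β = transIter (nonwanderingIn T) (β + 1)} α

/-- `depth^{(∞)}(X, T) = α`: the van der Waerden depth, the least ordinal `α` with
`Ω_α^{(∞)}(X, T) = Ω_{α+1}^{(∞)}(X, T)`. -/
def HasVdWDepth {X : Type} [TopologicalSpace X] (T : X → X) (α : Ordinal.{0}) : Prop :=
  IsLeast {β : Ordinal.{0} |
    transIter (multiNonwanderingIn T) β = transIter (multiNonwanderingIn T) (β + 1)} α

/-- `Γ_δ[x]`: the points whose full (two-sided) orbit stays within `δ` of that of `x`. -/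
def dynBall {X : Type} [MetricSpace X] (T : X ≃ₜ X) (δ : ℝ) (x : X) : Set X :=
  {y | ∀ k : ℤ, dist ((T ^ k : X ≃ₜ X) x) ((T ^ k : X ≃ₜ X) y) ≤ δ}

/-- `n`-expansiveness. -/
def IsNExpansive {X : Type} [MetricSpace X] (T : X ≃ₜ X) (n : ℕ) : Prop :=
  ∃ δ : ℝ, 0 < δ ∧ ∀ x : X, (dynBall T δ x).encard ≤ n

/-- Essential `n`-expansiveness: `n`-expansive, and for all small `δ > 0` some `Γ_δ[x]` has exactly
`n` points. (For `δ ≥ diam X` every `Γ_δ[x]` is all of `X`, so that `δ` has to be small.)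
For `n ≥ 1` this means `n`-expansive but not `(n-1)`-expansive, see below. -/
def IsEssentiallyNExpansive {X : Type} [MetricSpace X] (T : X ≃ₜ X) (n : ℕ) : Prop :=
  IsNExpansive T n ∧ ∃ δ₀ : ℝ, 0 < δ₀ ∧ ∀ δ : ℝ, 0 < δ → δ ≤ δ₀ →
    ∃ x : X, (dynBall T δ x).encard = n

theorem dynBall_mono {X : Type} [MetricSpace X] (T : X ≃ₜ X) {δ ε : ℝ} (h : δ ≤ ε) (x : X) :
    dynBall T δ x ⊆ dynBall T ε x :=
  fun _ hy k => (hy k).trans h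

theorem isEssentiallyNExpansive_iff {X : Type} [MetricSpace X] (T : X ≃ₜ X) (n : ℕ) :
    IsEssentiallyNExpansive T (n + 1) ↔ IsNExpansive T (n + 1) ∧ ¬ IsNExpansive T n := by
  constructor
  · rintro ⟨h1, δ₀, h0, h⟩
    refine ⟨h1, ?_⟩
    rintro ⟨ε, hε, hn⟩
    obtain ⟨x, hx⟩ := h (min ε δ₀) (lt_min hε h0) (min_le_right _ _)
    have h2 := (encard_le_encard (dynBall_mono T (min_le_left ε δ₀) x)).trans (hn x)
    rw [hx] at h2
    have h3 : n + 1 ≤ n := by exact_mod_cast h2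
    omega
  · rintro ⟨⟨δ₀, h0, h⟩, hn⟩
    refine ⟨⟨δ₀, h0, h⟩, δ₀, h0, fun δ hδ hle => ?_⟩
    by_contra! hne
    refine hn ⟨δ, hδ, fun x => ?_⟩
    have h2 := lt_of_le_of_ne
      ((encard_le_encard (dynBall_mono T hle x)).trans (h x)) (hne x)
    push_cast at h2
    exact ENat.lt_natCast_add_one_iff.1 h2

/-! Write `α = β + 1` with `β ≥ 1`. The system is built from a countable subshift `Y` of finitely
supported 0-1 sequences with an ordinal rank. The zero sequence is the only periodic point and has
rank `β + 1`, and the sequences with a single one have rank `β`. Each nonzero point has strictly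
larger rank than the other points near it, and every smaller rank recurs near it along arithmetic
progressions of times. Strict decrease makes a point of rank `γ` isolated in the level set of ranks
at least `γ`, hence wandering there unless it is periodic. Recurrence keeps every point of larger
rank multi-non-wandering. So the derived sets and both kinds of centre sequence are the level sets
of the rank, and all three invariants equal `α` (`IsDynRank`).

`Y` is built by induction on `β` (`exists_isRanked`). Take sets of all ranks below `β`, each used
infinitely often, and in the `i`-th one replace every one by `i + 2` ones in progression of
difference `K = N + 1 + i`. As `i` grows, the image of a spike, and its translates by `K`, `2K`,
..., look like that spike in any fixed window; this is van der Waerden recurrence. Wide gaps in the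
`i`-th set make the substitution injective, and the least distance between ones reveals `i`, so the
pieces do not interfere (`IsGlueable.isRanked`).

A subshift is expansive. To get exactly `n`, every nonzero point of rank zero is split into `n`
points (`fan`). The copies are isolated, so the rank argument survives. By compactness only finitely
many fibres have two points `δ` apart, and some orbit avoids them all: along it the `n` copies are
never separated (`isEssentiallyNExpansive_of_factor`, `IsRanked.exists_orbit_avoiding`). -/

/-! ### Ranks that compute the derived degree and both depths. -/

/-- A rank function on a system for which the transfinite derived sets, the sets of non-wandering
points and the sets of multi-non-wandering points are all upper level sets of the rank. -/
structure IsDynRank {X : Type} [TopologicalSpace X] (T : X → X) (r : X → Ordinal.{0}) (o : X)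
    (α : Ordinal.{0}) : Prop where
  rank_top : r o = α
  map_top : T o = o
  lt_top : ∀ x, x ≠ o → r x < α
  aperiodic : ∀ x, x ≠ o → ∀ k : ℕ, 1 ≤ k → T^[k] x ≠ x
  eventually_lt : ∀ x, ∀ᶠ y in 𝓝[≠] x, r y < r x
  recurrent : ∀ x, ∀ γ < r x, ∀ U ∈ 𝓝 x, ∀ d : ℕ, ∃ k : ℕ, 1 ≤ k ∧ ∃ z, z ≠ o ∧
    ∀ j ≤ d, T^[j * k] z ∈ U ∧ γ ≤ r (T^[j * k] z)

namespace IsDynRank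

theorem transIter_eq {X : Type} {r : X → Ordinal.{0}} {α : Ordinal.{0}} {F : Set X → Set X}
    (hF : ∀ γ < α, F {x | γ ≤ r x} = {x | γ + 1 ≤ r x}) (γ : Ordinal.{0}) (hγ : γ ≤ α) :
    transIter F γ = {x | γ ≤ r x} := by
  induction γ using Ordinal.limitRecOn with
  | zero => simp [transIter_zero]
  | add_one γ ih =>
    have hlt : γ < α := (lt_add_one γ).trans_le hγ
    rw [transIter_add_one, ih hlt.le, hF γ hlt]
  | limit γ hl ih =>
    rw [transIter_limit F γ hl]
    ext x
    simp only [mem_iInter, mem_ofPred_eq]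
    constructor
    · intro hx
      by_contra! hlt
      have h1 := hx (r x + 1) (hl.add_one_lt hlt)
      rw [ih _ (hl.add_one_lt hlt) ((hl.add_one_lt hlt).le.trans hγ)] at h1
      exact (not_le.2 (lt_add_one (r x))) (show r x + 1 ≤ r x from h1)
    · intro hx β hβ
      rw [ih β hβ (hβ.le.trans hγ)]
      exact hβ.le.trans hx

variable {X : Type} [TopologicalSpace X] {T : X → X} {r : X → Ordinal.{0}} {o : X}
  {α : Ordinal.{0}}

theorem rank_le (h : IsDynRank T r o α) (x : X) : r x ≤ α := by
  by_cases hx : x = o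
  · rw [hx, h.rank_top]
  · exact (h.lt_top x hx).le

/-- Recurrence with `d = 1` gives two points `z` and `T^[k] z` in `U`. They differ because `z` is
aperiodic, so one of them is not `x`. -/
theorem exists_ne (h : IsDynRank T r o α) {x : X} {γ : Ordinal.{0}} (hγ : γ < r x)
    {U : Set X} (hU : U ∈ 𝓝 x) : ∃ z ∈ U, z ≠ x ∧ γ ≤ r z := by
  obtain ⟨k, hk, z, hz, hj⟩ := h.recurrent x γ hγ U hU 1
  have h0 := hj 0 (by omega)
  have h1 := hj 1 le_rfl
  simp only [zero_mul, Function.iterate_zero, id_eq, one_mul] at h0 h1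
  by_cases hzx : z = x
  · refine ⟨_, h1.1, ?_, h1.2⟩
    rw [← hzx]
    exact h.aperiodic z hz k hk
  · exact ⟨z, h0.1, hzx, h0.2⟩

theorem derivedSet_le (h : IsDynRank T r o α) (γ : Ordinal.{0}) :
    derivedSet {x | γ ≤ r x} = {x | γ + 1 ≤ r x} := by
  ext x
  rw [mem_derivedSet, accPt_iff_nhds]
  simp only [mem_ofPred_eq, ← Order.succ_eq_add_one, Order.succ_le_iff]
  constructor
  · intro hx
    obtain ⟨U, hU, hlt⟩ := (eventually_nhdsWithin_iff.1 (h.eventually_lt x)).exists_mem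
    obtain ⟨y, ⟨hy, hγ⟩, hyx⟩ := hx U hU
    exact lt_of_le_of_lt hγ (hlt y hy hyx)
  · intro hx U hU
    obtain ⟨z, hz, hne, hr⟩ := h.exists_ne hx hU
    exact ⟨z, ⟨hz, hr⟩, hne⟩

/-- A point of rank exactly `γ` is alone in its level set near itself, so a return to that
neighbourhood would make it periodic. The bound `γ < α` rules out the fixed point `o`. -/
theorem nonwanderingIn_subset (h : IsDynRank T r o α) {γ : Ordinal.{0}} (hγ : γ < α) :
    nonwanderingIn T {x | γ ≤ r x} ⊆ {x | γ + 1 ≤ r x} := by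
  rintro x ⟨hx, hU⟩
  rw [mem_ofPred_eq, ← Order.succ_eq_add_one, Order.succ_le_iff]
  refine lt_of_le_of_ne hx fun he => ?_
  have hxo : x ≠ o := by
    rintro rfl
    exact hγ.ne (he.trans h.rank_top)
  obtain ⟨U, hUx, hlt⟩ := (eventually_nhdsWithin_iff.1 (h.eventually_lt x)).exists_mem
  obtain ⟨k, hk, z, ⟨hzU, hz⟩, hkU, hkz⟩ := hU U hUx
  have key : ∀ y ∈ U, γ ≤ r y → y = x := by
    intro y hy hyr
    by_contra hne
    exact absurd (hlt y hy hne) (by rw [← he]; exact not_lt.2 hyr)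
  have e1 := key z hzU hz
  have e2 := key _ hkU hkz
  rw [e1] at e2
  exact h.aperiodic x hxo k hk e2

theorem multiNonwanderingIn_subset {X : Type} [TopologicalSpace X] (T : X → X) (A : Set X) :
    multiNonwanderingIn T A ⊆ nonwanderingIn T A := by
  rintro x ⟨hx, hU⟩
  refine ⟨hx, fun U hUx => ?_⟩
  obtain ⟨k, hk, z, hz⟩ := hU U hUx 1 le_rfl
  simp only [mem_iInter, Finset.mem_range] at hz
  have h0 := hz 0 (by omega)
  have h1 := hz 1 (by omega)
  simp only [zero_mul, Function.iterate_zero, one_mul] at h0 h1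
  exact ⟨k, hk, z, h0, h1⟩

theorem subset_multiNonwanderingIn (h : IsDynRank T r o α) (γ : Ordinal.{0}) :
    {x | γ + 1 ≤ r x} ⊆ multiNonwanderingIn T {x | γ ≤ r x} := by
  intro x hx
  rw [mem_ofPred_eq, ← Order.succ_eq_add_one, Order.succ_le_iff] at hx
  refine ⟨hx.le, fun U hU d _ => ?_⟩
  obtain ⟨k, hk, z, -, hz⟩ := h.recurrent x γ hx U hU d
  refine ⟨k, hk, z, ?_⟩
  simp only [mem_iInter, Finset.mem_range]
  intro j hj
  exact hz j (by omega)

/-- Descent on the rank: while it exceeds `γ`, a nearby point has smaller rank, still at least `γ`.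
Applied at `o`, this shows that no level is skipped, so the level sets strictly decrease up to `α`.
-/
theorem exists_rank_eq_of_mem_nhds (h : IsDynRank T r o α) {γ : Ordinal.{0}} {x : X}
    (hx : γ ≤ r x) {U : Set X} (hU : IsOpen U) (hxU : x ∈ U) : ∃ z ∈ U, r z = γ := by
  induction hρ : r x using WellFoundedLT.induction generalizing x with
  | ind ρ ih =>
    rcases hx.eq_or_lt with he | hlt
    · exact ⟨x, hxU, he.symm⟩
    · have hV := eventually_nhdsWithin_iff.1 (h.eventually_lt x)
      obtain ⟨z, ⟨hzU, hz⟩, hne, hr⟩ :=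
        h.exists_ne hlt (Filter.inter_mem (hU.mem_nhds hxU) hV)
      exact ih (r z) (by rw [← hρ]; exact hz hne) hr hzU rfl

theorem setOf_top_le (h : IsDynRank T r o α) : {x | α ≤ r x} = {o} := by
  ext x
  simp only [mem_ofPred_eq, mem_singleton_iff]
  constructor
  · intro hx
    by_contra hne
    exact absurd (h.lt_top x hne) (not_lt.2 hx)
  · rintro rfl
    exact h.rank_top.ge

theorem isLeast_of_level (h : IsDynRank T r o α) {F : Set X → Set X}
    (hF : ∀ γ < α, F {x | γ ≤ r x} = {x | γ + 1 ≤ r x}) (hFo : F {o} = {o}) :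
    IsLeast {β : Ordinal.{0} | transIter F β = transIter F (β + 1)} α := by
  constructor
  · rw [mem_ofPred_eq, transIter_add_one, transIter_eq hF α le_rfl, h.setOf_top_le, hFo]
  · intro γ hγ
    by_contra! hlt
    have hle : γ + 1 ≤ α := by rwa [← Order.succ_eq_add_one, Order.succ_le_iff]
    rw [mem_ofPred_eq, transIter_eq hF γ hlt.le, transIter_eq hF _ hle] at hγ
    obtain ⟨z, -, hz⟩ := h.exists_rank_eq_of_mem_nhds (x := o) (γ := γ)
      (by rw [h.rank_top]; exact hlt.le) isOpen_univ (mem_univ _)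
    have h1 : z ∈ {x | γ + 1 ≤ r x} := by rw [← hγ]; exact hz.ge
    rw [mem_ofPred_eq, hz] at h1
    exact absurd h1 (not_le.2 (lt_add_one _))

theorem hasDerivedDegree (h : IsDynRank T r o α) : HasDerivedDegree X α := by
  have hα := transIter_eq (fun γ _ => h.derivedSet_le γ) α le_rfl
  constructor
  · rw [derivedSetOrd, hα, h.setOf_top_le]
    exact singleton_nonempty o
  · rw [derivedSetOrd, transIter_add_one, hα, h.derivedSet_le]
    ext x
    simp only [mem_ofPred_eq, mem_empty_iff_false, iff_false, not_le]
    exact (h.rank_le x).trans_lt (lt_add_one _)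

theorem iterate_top (h : IsDynRank T r o α) (k : ℕ) : T^[k] o = o :=
  Function.iterate_fixed h.map_top k

theorem top_mem_multiNonwanderingIn (h : IsDynRank T r o α) :
    o ∈ multiNonwanderingIn T {o} := by
  refine ⟨rfl, fun U hU d _ => ⟨1, le_rfl, o, ?_⟩⟩
  simp only [mem_iInter, mem_preimage, h.iterate_top]
  exact fun _ _ => ⟨mem_of_mem_nhds hU, rfl⟩

theorem hasDepth (h : IsDynRank T r o α) : HasDepth T α := by
  refine h.isLeast_of_level (fun γ hγ => Subset.antisymm (h.nonwanderingIn_subset hγ)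
    ((h.subset_multiNonwanderingIn γ).trans (multiNonwanderingIn_subset T _))) ?_
  exact Subset.antisymm (fun x hx => hx.1)
    (singleton_subset_iff.2 (multiNonwanderingIn_subset T _ h.top_mem_multiNonwanderingIn))

theorem hasVdWDepth (h : IsDynRank T r o α) : HasVdWDepth T α := by
  refine h.isLeast_of_level (fun γ hγ => Subset.antisymm
    ((multiNonwanderingIn_subset T _).trans (h.nonwanderingIn_subset hγ))
    (h.subset_multiNonwanderingIn γ)) ?_
  exact Subset.antisymm (fun x hx => hx.1) (singleton_subset_iff.2 h.top_mem_multiNonwanderingIn)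

end IsDynRank

/-! ### Two-sided 0-1 sequences and the substitution by progressions. -/

namespace BiSeq

/-- The zero sequence. -/
def zero : ℤ → Bool := fun _ => false

/-- The sequence whose only nonzero entry is at `a`. -/
def spike (a : ℤ) : ℤ → Bool := fun n => decide (n = a)

/-- The `k`-th power of the shift on two-sided sequences. -/
def shift (k : ℤ) (x : ℤ → Bool) : ℤ → Bool := fun n => x (n + k)

/-- Replace every one of `x` by `m + 1` ones in an arithmetic progression of difference `k`. -/
def spread (k m : ℕ) (x : ℤ → Bool) : ℤ → Bool :=
  fun n => decide (∃ j : Fin (m + 1), x (n - (j : ℕ) * k) = true)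

/-- A left inverse of `spread k m` on sequences with large gaps. -/
def gather (k : ℕ) (x : ℤ → Bool) : ℤ → Bool := fun n => x n && !x (n - k)

/-- Any two ones of `x` are more than `N` apart. -/
def HasGap (N : ℕ) (x : ℤ → Bool) : Prop :=
  ∀ a b : ℤ, x a = true → x b = true → a < b → (N : ℤ) < b - a

theorem spike_apply {a n : ℤ} : spike a n = true ↔ n = a := by simp [spike]

theorem spread_apply {k m : ℕ} {x : ℤ → Bool} {n : ℤ} :
    spread k m x n = true ↔ ∃ j : ℕ, j ≤ m ∧ x (n - j * k) = true := by
  simp [spread, Fin.exists_iff]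

theorem ne_zero_iff {x : ℤ → Bool} : x ≠ zero ↔ ∃ a, x a = true := by
  simp [zero, funext_iff]

theorem spike_ne_zero (a : ℤ) : spike a ≠ zero := ne_zero_iff.2 ⟨a, spike_apply.2 rfl⟩

theorem shift_shift (j k : ℤ) (x : ℤ → Bool) : shift j (shift k x) = shift (j + k) x := by
  funext n
  simp [shift, add_assoc]

@[simp] theorem shift_zero_left (x : ℤ → Bool) : shift 0 x = x := by
  funext n
  simp [shift]

theorem shift_spike (k a : ℤ) : shift k (spike a) = spike (a - k) := by
  funext n
  simp only [shift, spike, decide_eq_decide]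
  omega

theorem shift_spread (k m : ℕ) (l : ℤ) (x : ℤ → Bool) :
    shift l (spread k m x) = spread k m (shift l x) := by
  funext n
  simp only [shift, spread, sub_add_eq_add_sub]

theorem continuous_apply_bool (n : ℤ) : Continuous fun x : ℤ → Bool => x n := continuous_apply n

theorem continuous_shift (k : ℤ) : Continuous (shift k) :=
  continuous_pi fun n => continuous_apply_bool (n + k)

theorem continuous_spread (k m : ℕ) : Continuous (spread k m) := by
  refine continuous_pi fun n => ?_
  have h : (fun x : ℤ → Bool => spread k m x n) =
      (fun u : Fin (m + 1) → Bool => decide (∃ j, u j = true)) ∘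
        fun x j => x (n - (j : ℕ) * k) := by
    rfl
  rw [h]
  exact continuous_of_discreteTopology.comp (continuous_pi fun j => continuous_apply_bool _)

theorem continuous_gather (k : ℕ) : Continuous (gather k) := by
  refine continuous_pi fun n => ?_
  exact (continuous_of_discreteTopology (f := fun p : Bool × Bool => p.1 && !p.2)).comp
    ((continuous_apply_bool n).prodMk (continuous_apply_bool (n - k)))

theorem eventually_apply_eq (x : ℤ → Bool) (n : ℤ) : ∀ᶠ y in 𝓝 x, y n = x n :=
  (continuous_apply_bool n).continuousAt.eventually_mem (by simp : {x n} ∈ 𝓝 (x n))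

theorem eventually_ne {x y : ℤ → Bool} (h : x ≠ y) : ∀ᶠ z in 𝓝 x, z ≠ y :=
  isOpen_ne.mem_nhds h

theorem exists_cylinder_subset {x : ℤ → Bool} {U : Set (ℤ → Bool)} (hU : U ∈ 𝓝 x) :
    ∃ M : ℕ, ∀ y : ℤ → Bool, (∀ n : ℤ, n.natAbs ≤ M → y n = x n) → y ∈ U := by
  obtain ⟨V, hVU, hV, hx⟩ := mem_nhds_iff.1 hU
  obtain ⟨I, u, hu, hsub⟩ := isOpen_pi_iff.1 hV x hx
  refine ⟨I.sup Int.natAbs, fun y hy => hVU (hsub fun n hn => ?_)⟩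
  rw [hy n (Finset.le_sup (f := Int.natAbs) hn)]
  exact (hu n hn).2

theorem spread_zero (k m : ℕ) : spread k m zero = zero := by
  funext n
  simp [spread, zero]

theorem spread_apply_of_apply {k m : ℕ} {x : ℤ → Bool} {a : ℤ} (ha : x a = true) {j : ℕ}
    (hj : j ≤ m) : spread k m x (a + j * k) = true :=
  spread_apply.2 ⟨j, hj, by rwa [add_sub_cancel_right]⟩

theorem spread_ne_zero {k m : ℕ} {x : ℤ → Bool} (hx : x ≠ zero) : spread k m x ≠ zero := by
  obtain ⟨a, ha⟩ := ne_zero_iff.1 hx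
  exact ne_zero_iff.2 ⟨_, spread_apply_of_apply ha (Nat.zero_le m)⟩

/-- `gather` keeps the ones not preceded by a one at distance `k`, that is, the first term of each
progression. The gap stops one progression from running into the start of the next. -/
theorem gather_spread {k m : ℕ} (hk : 1 ≤ k) {x : ℤ → Bool} (hx : HasGap ((m + 1) * k) x) :
    gather k (spread k m x) = x := by
  funext n
  rw [Bool.eq_iff_iff]
  simp only [gather, Bool.and_eq_true, Bool.not_eq_true']
  constructor
  · rintro ⟨h1, h2⟩
    obtain ⟨j, hj, hxj⟩ := spread_apply.1 h1
    rcases j with _ | j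
    · simpa using hxj
    · have : spread k m x (n - k) = true := by
        refine spread_apply.2 ⟨j, by omega, ?_⟩
        rw [← hxj]
        congr 1
        push_cast
        ring
      rw [h2] at this
      cases this
  · intro h
    refine ⟨by simpa using spread_apply_of_apply (k := k) h (Nat.zero_le m), ?_⟩
    rw [← Bool.not_eq_true]
    intro h2
    obtain ⟨j, hj, hxj⟩ := spread_apply.1 h2
    have hk' : (1 : ℤ) ≤ k := by exact_mod_cast hk
    have hj' : (j : ℤ) ≤ m := by exact_mod_cast hj
    have hg := hx _ _ hxj h (by nlinarith)
    push_cast at hg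
    nlinarith

theorem spread_gap {k m : ℕ} {x : ℤ → Bool} (hx : HasGap ((m + 1) * k) x) {a b : ℤ}
    (ha : spread k m x a = true) (hb : spread k m x b = true) (hab : a < b) :
    (k : ℤ) ≤ b - a := by
  obtain ⟨j, hj, hxj⟩ := spread_apply.1 ha
  obtain ⟨l, hl, hxl⟩ := spread_apply.1 hb
  have hj' : (j : ℤ) ≤ m := by exact_mod_cast hj
  have hl' : (l : ℤ) ≤ m := by exact_mod_cast hl
  have hk : (0 : ℤ) ≤ k := by positivity
  rcases lt_trichotomy (a - j * k) (b - l * k) with h | h | h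
  · have hg := hx _ _ hxj hxl h
    push_cast at hg
    nlinarith
  · have h1 : (j : ℤ) < l := by
      by_contra! hle
      nlinarith
    nlinarith
  · have hg := hx _ _ hxl hxj h
    push_cast at hg
    nlinarith

theorem countable_of_bounded :
    {x : ℤ → Bool | ∃ M : ℕ, ∀ n, x n = true → n.natAbs ≤ M}.Countable := by
  refine (countable_range fun s : Finset ℤ => fun n => decide (n ∈ s)).mono ?_
  rintro x ⟨M, hM⟩
  refine ⟨(Finset.Icc (-M : ℤ) M).filter fun n => x n = true, ?_⟩
  funext n
  rw [Bool.eq_iff_iff]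
  simp only [Finset.mem_filter, Finset.mem_Icc, decide_eq_true_eq, and_iff_right_iff_imp]
  intro hn
  have := hM n hn
  omega

/-! ### Ranked sets and their gluing. -/

/-- A shift-invariant set of sequences with finitely many, widely spaced ones, with a rank that
governs the topology and the recurrence of its nonzero points, and is `β` at the spikes. -/
structure IsRanked (β : Ordinal.{0}) (N : ℕ) (Y : Set (ℤ → Bool))
    (r : (ℤ → Bool) → Ordinal.{0}) : Prop where
  isClosed : IsClosed Y
  shift_mem : ∀ x ∈ Y, ∀ k, shift k x ∈ Y
  zero_mem : zero ∈ Y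
  spike_mem : ∀ a, spike a ∈ Y
  rank_spike : ∀ a, r (spike a) = β
  rank_le : ∀ x ∈ Y, x ≠ zero → r x ≤ β
  rank_shift : ∀ x ∈ Y, x ≠ zero → ∀ k, r (shift k x) = r x
  bounded : ∀ x ∈ Y, ∃ M : ℕ, ∀ n, x n = true → n.natAbs ≤ M
  gap : ∀ x ∈ Y, HasGap N x
  eventually_lt : ∀ x ∈ Y, x ≠ zero → ∀ᶠ y in 𝓝 x, y ∈ Y → y ≠ x → r y < r x
  recurrent : ∀ x ∈ Y, x ≠ zero → ∀ γ < r x, ∀ U ∈ 𝓝 x, ∀ d : ℕ, ∃ k : ℕ, 1 ≤ k ∧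
    ∃ z ∈ Y, z ≠ zero ∧ γ ≤ r z ∧ ∀ j ≤ d, shift ((j * k : ℕ) : ℤ) z ∈ U

/-- The union of the spikes and of the images under `spread` of the sets `Z i` with `b i < β`. -/
def glue (β : Ordinal.{0}) (N : ℕ) (b : ℕ → Ordinal.{0}) (Z : ℕ → Set (ℤ → Bool)) :
    Set (ℤ → Bool) :=
  {x | x = zero ∨ (∃ a, x = spike a) ∨ ∃ i, b i < β ∧ ∃ y ∈ Z i, x = spread (N + 1 + i) (i + 1) y}

open Classical in
/-- The rank on `glue β N b Z` induced by ranks on the sets `Z i`. -/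
noncomputable def glueRank (β : Ordinal.{0}) (N : ℕ) (b : ℕ → Ordinal.{0})
    (Z : ℕ → Set (ℤ → Bool)) (r : ℕ → (ℤ → Bool) → Ordinal.{0}) (x : ℤ → Bool) : Ordinal.{0} :=
  if ∃ a, x = spike a then β
  else if h : ∃ i, b i < β ∧ ∃ y ∈ Z i, x = spread (N + 1 + i) (i + 1) y then
    r h.choose (gather (N + 1 + h.choose) x)
  else 0

/-- The hypotheses under which `glue` gives a ranked set. -/
structure IsGlueable (β : Ordinal.{0}) (N : ℕ) (b : ℕ → Ordinal.{0}) (Z : ℕ → Set (ℤ → Bool))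
    (r : ℕ → (ℤ → Bool) → Ordinal.{0}) : Prop where
  ranked : ∀ i, b i < β → IsRanked (b i) ((i + 1 + 1) * (N + 1 + i)) (Z i) (r i)
  cofinal : ∀ γ < β, ∀ M : ℕ, ∃ i, M ≤ i ∧ b i = γ

namespace IsGlueable

variable {β : Ordinal.{0}} {N : ℕ} {b : ℕ → Ordinal.{0}} {Z : ℕ → Set (ℤ → Bool)}
  {r : ℕ → (ℤ → Bool) → Ordinal.{0}}

theorem gather_spread (h : IsGlueable β N b Z r) {i : ℕ} (hi : b i < β) {y : ℤ → Bool}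
    (hy : y ∈ Z i) : gather (N + 1 + i) (spread (N + 1 + i) (i + 1) y) = y :=
  BiSeq.gather_spread (by omega) ((h.ranked i hi).gap y hy)

theorem gap_spread (h : IsGlueable β N b Z r) {i : ℕ} (hi : b i < β) {y : ℤ → Bool}
    (hy : y ∈ Z i) {c d : ℤ} (hc : spread (N + 1 + i) (i + 1) y c = true)
    (hd : spread (N + 1 + i) (i + 1) y d = true) (hcd : c < d) : (N + 1 + i : ℤ) ≤ d - c := by
  exact_mod_cast spread_gap ((h.ranked i hi).gap y hy) hc hd hcd

theorem exists_pair {i : ℕ} {y : ℤ → Bool} (hy : y ≠ zero) :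
    ∃ c, spread (N + 1 + i) (i + 1) y c = true ∧
      spread (N + 1 + i) (i + 1) y (c + (N + 1 + i)) = true := by
  obtain ⟨a, ha⟩ := ne_zero_iff.1 hy
  refine ⟨a, ?_, ?_⟩
  · simpa using spread_apply_of_apply (k := N + 1 + i) (m := i + 1) ha (Nat.zero_le _)
  · simpa using spread_apply_of_apply (k := N + 1 + i) (m := i + 1) ha (j := 1) (by omega)

theorem spread_ne_spike {i : ℕ} {y : ℤ → Bool} (hy : y ≠ zero) (a : ℤ) :
    spread (N + 1 + i) (i + 1) y ≠ spike a := by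
  obtain ⟨c, h1, h2⟩ := exists_pair (N := N) (i := i) hy
  intro he
  rw [he, spike_apply] at h1 h2
  omega

theorem index_le (h : IsGlueable β N b Z r) {i : ℕ} (hi : b i < β) {y x : ℤ → Bool} (hy : y ∈ Z i)
    (hx : x = spread (N + 1 + i) (i + 1) y) {c d : ℤ} (hc : x c = true) (hd : x d = true)
    (hcd : c < d) : (N + 1 + i : ℤ) ≤ d - c := by
  subst hx
  exact h.gap_spread hi hy hc hd hcd

/-- The index is read off from the least distance between two ones, which is `N + 1 + i` and is
attained inside every progression. -/
theorem index_unique (h : IsGlueable β N b Z r) {i j : ℕ} (hi : b i < β) (hj : b j < β)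
    {y z : ℤ → Bool} (hy : y ∈ Z i) (hz : z ∈ Z j) (hy0 : y ≠ zero) (hz0 : z ≠ zero)
    (he : spread (N + 1 + i) (i + 1) y = spread (N + 1 + j) (j + 1) z) : i = j := by
  obtain ⟨c, h1, h2⟩ := exists_pair (N := N) (i := i) hy0
  obtain ⟨d, h3, h4⟩ := exists_pair (N := N) (i := j) hz0
  have e1 := h.index_le hj hz he h1 h2 (by omega)
  have e2 := h.index_le hi hy he.symm h3 h4 (by omega)
  omega

theorem rank_spread (h : IsGlueable β N b Z r) {i : ℕ} (hi : b i < β) {y : ℤ → Bool}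
    (hy : y ∈ Z i) (hy0 : y ≠ zero) :
    glueRank β N b Z r (spread (N + 1 + i) (i + 1) y) = r i y := by
  have hex : ∃ j, b j < β ∧ ∃ z ∈ Z j,
      spread (N + 1 + i) (i + 1) y = spread (N + 1 + j) (j + 1) z := ⟨i, hi, y, hy, rfl⟩
  have hj : i = hex.choose := by
    obtain ⟨hb, z, hz, he⟩ := hex.choose_spec
    refine h.index_unique hi hb hy hz hy0 ?_ he
    rintro rfl
    exact spread_ne_zero hy0 (he.trans (spread_zero _ _))
  rw [glueRank, if_neg (fun ⟨a, ha⟩ => spread_ne_spike hy0 a ha), dif_pos hex, ← hj,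
    h.gather_spread hi hy]

theorem rank_spike (a : ℤ) : glueRank β N b Z r (spike a) = β := if_pos ⟨a, rfl⟩

theorem mem_cases {x : ℤ → Bool} (hx : x ∈ glue β N b Z) (hx0 : x ≠ zero) :
    (∃ a, x = spike a) ∨
      ∃ i, b i < β ∧ ∃ y ∈ Z i, y ≠ zero ∧ x = spread (N + 1 + i) (i + 1) y := by
  rcases hx with h | h | ⟨i, hi, y, hy, rfl⟩
  · exact absurd h hx0
  · exact Or.inl h
  · refine Or.inr ⟨i, hi, y, hy, ?_, rfl⟩
    rintro rfl
    exact hx0 (spread_zero _ _)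

theorem isClosed_piece (h : IsGlueable β N b Z r) (j : ℕ) :
    IsClosed {x | b j < β ∧ ∃ y ∈ Z j, x = spread (N + 1 + j) (j + 1) y} := by
  by_cases hj : b j < β
  · have : {x | b j < β ∧ ∃ y ∈ Z j, x = spread (N + 1 + j) (j + 1) y} =
        spread (N + 1 + j) (j + 1) '' Z j := by
      ext x
      simp only [hj, true_and, mem_ofPred_eq, mem_image, eq_comm]
    rw [this]
    exact ((h.ranked j hj).isClosed.isCompact.image (continuous_spread _ _)).isClosed
  · simp [hj]

theorem eventually_index_le (h : IsGlueable β N b Z r) {x : ℤ → Bool} {c : ℤ} {l : ℕ}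
    (hc : x c = true) (hd : x (c + (N + 1 + l)) = true) :
    ∀ᶠ x' in 𝓝 x, x' ∈ glue β N b Z →
      ∃ j ≤ l, b j < β ∧ ∃ y ∈ Z j, x' = spread (N + 1 + j) (j + 1) y := by
  filter_upwards [eventually_apply_eq x c, eventually_apply_eq x (c + (N + 1 + l))] with x' h1 h2 hx'
  rw [hc] at h1
  rw [hd] at h2
  rcases mem_cases hx' (ne_zero_iff.2 ⟨c, h1⟩) with ⟨a, rfl⟩ | ⟨j, hj, y, hy, -, he⟩
  · rw [spike_apply] at h1 h2
    omega
  · have := h.index_le hj hy he h1 h2 (by omega)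
    exact ⟨j, by omega, hj, y, hy, he⟩

/-- Away from zero each piece is open in the union: a pair of ones at distance `N + 1 + i` persists
nearby and bounds the index by `i`, and the finitely many pieces of smaller index are closed and
miss the point. -/
theorem eventually_spread (h : IsGlueable β N b Z r) {i : ℕ} (hi : b i < β) {y : ℤ → Bool}
    (hy : y ∈ Z i) (hy0 : y ≠ zero) :
    ∀ᶠ x' in 𝓝 (spread (N + 1 + i) (i + 1) y), x' ∈ glue β N b Z →
      ∃ y' ∈ Z i, y' ≠ zero ∧ x' = spread (N + 1 + i) (i + 1) y' := by
  obtain ⟨c, h1, h2⟩ := exists_pair (N := N) (i := i) hy0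
  have hout : ∀ᶠ x' in 𝓝 (spread (N + 1 + i) (i + 1) y), ∀ j ∈ Finset.range i,
      ¬ (b j < β ∧ ∃ z ∈ Z j, x' = spread (N + 1 + j) (j + 1) z) := by
    rw [Filter.eventually_all_finset]
    intro j hj
    refine (h.isClosed_piece j).isOpen_compl.mem_nhds ?_
    rintro ⟨hjβ, z, hz, he⟩
    refine (Finset.mem_range.1 hj).ne' (h.index_unique hi hjβ hy hz hy0 ?_ he)
    rintro rfl
    exact spread_ne_zero hy0 (he.trans (spread_zero _ _))
  filter_upwards [h.eventually_index_le h1 h2, hout, eventually_ne (spread_ne_zero hy0)]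
    with x' h3 h4 h5 hx'
  obtain ⟨j, hj, hjβ, z, hz, he⟩ := h3 hx'
  rcases hj.lt_or_eq with hlt | rfl
  · exact absurd ⟨hjβ, z, hz, he⟩ (h4 j (Finset.mem_range.2 hlt))
  · refine ⟨z, hz, ?_, he⟩
    rintro rfl
    exact h5 (he.trans (spread_zero _ _))

/-- Two ones in a limit point bound the index of the approximating points, leaving finitely many
closed pieces. A limit with at most one one is zero or a spike. -/
theorem isClosed_glue (h : IsGlueable β N b Z r) : IsClosed (glue β N b Z) := by
  rw [isClosed_iff_frequently]
  intro x hx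
  by_cases hpair : ∃ c d, x c = true ∧ x d = true ∧ c < d
  · obtain ⟨c, d, hc, hd, hcd⟩ := hpair
    have hev : ∀ᶠ x' in 𝓝 x, x' ∈ glue β N b Z → x' ∈ ⋃ j ∈ Finset.range (d - c).toNat,
        {x | b j < β ∧ ∃ y ∈ Z j, x = spread (N + 1 + j) (j + 1) y} := by
      filter_upwards [eventually_apply_eq x c, eventually_apply_eq x d] with x' h1 h2 hx'
      rw [hc] at h1
      rw [hd] at h2
      rcases mem_cases hx' (ne_zero_iff.2 ⟨c, h1⟩) with ⟨a, rfl⟩ | ⟨j, hj, y, hy, -, he⟩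
      · rw [spike_apply] at h1 h2
        omega
      · have := h.index_le hj hy he h1 h2 hcd
        simp only [mem_iUnion]
        exact ⟨j, Finset.mem_range.2 (by omega), hj, y, hy, he⟩
    have hcl : IsClosed (⋃ j ∈ Finset.range (d - c).toNat,
        {x | b j < β ∧ ∃ y ∈ Z j, x = spread (N + 1 + j) (j + 1) y}) :=
      isClosed_biUnion_finset fun j _ => h.isClosed_piece j
    have hmem := isClosed_iff_frequently.1 hcl x (hx.mp hev)
    simp only [mem_iUnion] at hmem
    obtain ⟨j, -, hj, y, hy, he⟩ := hmem
    exact Or.inr (Or.inr ⟨j, hj, y, hy, he⟩)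
  · by_cases hx0 : x = zero
    · exact Or.inl hx0
    · obtain ⟨a, ha⟩ := ne_zero_iff.1 hx0
      refine Or.inr (Or.inl ⟨a, ?_⟩)
      funext n
      rw [Bool.eq_iff_iff, spike_apply]
      constructor
      · intro hn
        by_contra hne
        rcases lt_or_gt_of_ne hne with hlt | hlt
        · exact hpair ⟨n, a, hn, ha, hlt⟩
        · exact hpair ⟨a, n, ha, hn, hlt⟩
      · rintro rfl
        exact ha

theorem shift_mem_glue (h : IsGlueable β N b Z r) {x : ℤ → Bool} (hx : x ∈ glue β N b Z) (k : ℤ) :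
    shift k x ∈ glue β N b Z := by
  rcases hx with rfl | ⟨a, rfl⟩ | ⟨i, hi, y, hy, rfl⟩
  · exact Or.inl rfl
  · exact Or.inr (Or.inl ⟨_, shift_spike _ _⟩)
  · exact Or.inr (Or.inr ⟨i, hi, _, (h.ranked i hi).shift_mem y hy k, shift_spread _ _ _ _⟩)

theorem shift_ne_zero {x : ℤ → Bool} (hx : x ≠ zero) (k : ℤ) : shift k x ≠ zero := by
  obtain ⟨a, ha⟩ := ne_zero_iff.1 hx
  exact ne_zero_iff.2 ⟨a - k, by simpa [shift] using ha⟩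

theorem rank_shift_glue (h : IsGlueable β N b Z r) {x : ℤ → Bool} (hx : x ∈ glue β N b Z)
    (hx0 : x ≠ zero) (k : ℤ) : glueRank β N b Z r (shift k x) = glueRank β N b Z r x := by
  rcases mem_cases hx hx0 with ⟨a, rfl⟩ | ⟨i, hi, y, hy, hy0, rfl⟩
  · rw [shift_spike, rank_spike, rank_spike]
  · rw [shift_spread, h.rank_spread hi ((h.ranked i hi).shift_mem y hy k) (shift_ne_zero hy0 k),
      h.rank_spread hi hy hy0, (h.ranked i hi).rank_shift y hy hy0]

theorem bounded_glue (h : IsGlueable β N b Z r) {x : ℤ → Bool} (hx : x ∈ glue β N b Z) :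
    ∃ M : ℕ, ∀ n, x n = true → n.natAbs ≤ M := by
  rcases hx with rfl | ⟨a, rfl⟩ | ⟨i, hi, y, hy, rfl⟩
  · exact ⟨0, fun n hn => by cases hn⟩
  · refine ⟨a.natAbs, fun n hn => ?_⟩
    rw [spike_apply] at hn
    rw [hn]
  · obtain ⟨M, hM⟩ := (h.ranked i hi).bounded y hy
    refine ⟨M + (i + 1) * (N + 1 + i), fun n hn => ?_⟩
    obtain ⟨j, hj, hyj⟩ := spread_apply.1 hn
    have h1 := hM _ hyj
    have h2 : j * (N + 1 + i) ≤ (i + 1) * (N + 1 + i) := Nat.mul_le_mul_right _ hj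
    rw [← Nat.cast_mul] at h1
    omega

theorem gap_glue (h : IsGlueable β N b Z r) {x : ℤ → Bool} (hx : x ∈ glue β N b Z) :
    HasGap N x := by
  intro c d hc hd hcd
  rcases hx with rfl | ⟨a, rfl⟩ | ⟨i, hi, y, hy, rfl⟩
  · cases hc
  · rw [spike_apply] at hc hd
    omega
  · have := h.gap_spread hi hy hc hd hcd
    omega

theorem eventually_lt_glue (h : IsGlueable β N b Z r) {x : ℤ → Bool} (hx : x ∈ glue β N b Z)
    (hx0 : x ≠ zero) : ∀ᶠ x' in 𝓝 x, x' ∈ glue β N b Z → x' ≠ x →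
      glueRank β N b Z r x' < glueRank β N b Z r x := by
  rcases mem_cases hx hx0 with ⟨a, rfl⟩ | ⟨i, hi, y, hy, hy0, rfl⟩
  · filter_upwards [eventually_apply_eq (spike a) a] with x' h1 hx' hne
    rw [spike_apply.2 rfl] at h1
    rcases mem_cases hx' (ne_zero_iff.2 ⟨a, h1⟩) with ⟨c, rfl⟩ | ⟨i, hi, y, hy, hy0, rfl⟩
    · rw [spike_apply] at h1
      exact absurd (by rw [h1]) hne
    · rw [h.rank_spread hi hy hy0, rank_spike]
      exact ((h.ranked i hi).rank_le y hy hy0).trans_lt hi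
  · have hg : Filter.Tendsto (gather (N + 1 + i)) (𝓝 (spread (N + 1 + i) (i + 1) y)) (𝓝 y) := by
      have := (continuous_gather (N + 1 + i)).tendsto (spread (N + 1 + i) (i + 1) y)
      rwa [h.gather_spread hi hy] at this
    filter_upwards [h.eventually_spread hi hy hy0,
      hg.eventually ((h.ranked i hi).eventually_lt y hy hy0)] with x' h1 h2 hx' hne
    obtain ⟨y', hy', hy0', rfl⟩ := h1 hx'
    rw [h.gather_spread hi hy'] at h2
    rw [h.rank_spread hi hy hy0, h.rank_spread hi hy' hy0']
    exact h2 hy' fun he => hne (by rw [he])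

theorem recurrent_glue (h : IsGlueable β N b Z r) {x : ℤ → Bool} (hx : x ∈ glue β N b Z)
    (hx0 : x ≠ zero) {γ : Ordinal.{0}} (hγ : γ < glueRank β N b Z r x) {U : Set (ℤ → Bool)}
    (hU : U ∈ 𝓝 x) (d : ℕ) : ∃ k : ℕ, 1 ≤ k ∧ ∃ z ∈ glue β N b Z, z ≠ zero ∧
      γ ≤ glueRank β N b Z r z ∧ ∀ j ≤ d, shift ((j * k : ℕ) : ℤ) z ∈ U := by
  rcases mem_cases hx hx0 with ⟨a, rfl⟩ | ⟨i, hi, y, hy, hy0, rfl⟩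
  · rw [rank_spike] at hγ
    obtain ⟨M, hM⟩ := exists_cylinder_subset hU
    -- With `i` this large, the progression has more than `d` terms, and its difference is so large
    -- that every translate used shows only the one at `a` in the window `[-M, M]`.
    obtain ⟨i, hMi, rfl⟩ := h.cofinal γ hγ (M + a.natAbs + d)
    have hR := h.ranked i hγ
    refine ⟨N + 1 + i, by omega, spread (N + 1 + i) (i + 1) (spike a),
      Or.inr (Or.inr ⟨i, hγ, spike a, hR.spike_mem a, rfl⟩), spread_ne_zero (spike_ne_zero a), ?_, ?_⟩
    · rw [h.rank_spread hγ (hR.spike_mem a) (spike_ne_zero a), hR.rank_spike]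
    · intro j hj
      refine hM _ fun n hn => ?_
      rw [Bool.eq_iff_iff, spike_apply, shift, spread_apply]
      constructor
      · rintro ⟨l, hl, he⟩
        rw [spike_apply, Nat.cast_mul] at he
        set K : ℕ := N + 1 + i with hK
        have hk : (n - a).natAbs < K := by omega
        have hdvd : (K : ℤ) ∣ n - a := ⟨(l : ℤ) - j, by linear_combination he⟩
        have := Int.eq_zero_of_abs_lt_dvd hdvd (by rw [Int.abs_eq_natAbs]; omega)
        omega
      · rintro rfl
        refine ⟨j, by omega, ?_⟩
        rw [spike_apply]
        push_cast
        ring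
  · rw [h.rank_spread hi hy hy0] at hγ
    obtain ⟨k, hk, z, hz, hz0, hr, hj⟩ := (h.ranked i hi).recurrent y hy hy0 γ hγ _
      ((continuous_spread _ _).continuousAt.preimage_mem_nhds hU) d
    refine ⟨k, hk, _, Or.inr (Or.inr ⟨i, hi, z, hz, rfl⟩), spread_ne_zero hz0, ?_, ?_⟩
    · rwa [h.rank_spread hi hz hz0]
    · intro j hjd
      rw [shift_spread]
      exact hj j hjd

theorem isRanked (h : IsGlueable β N b Z r) :
    IsRanked β N (glue β N b Z) (glueRank β N b Z r) where
  isClosed := h.isClosed_glue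
  shift_mem _ hx k := h.shift_mem_glue hx k
  zero_mem := Or.inl rfl
  spike_mem a := Or.inr (Or.inl ⟨a, rfl⟩)
  rank_spike := rank_spike
  rank_le x hx hx0 := by
    rcases mem_cases hx hx0 with ⟨a, rfl⟩ | ⟨i, hi, y, hy, hy0, rfl⟩
    · exact (rank_spike a).le
    · rw [h.rank_spread hi hy hy0]
      exact ((h.ranked i hi).rank_le y hy hy0).trans hi.le
  rank_shift _ hx hx0 k := h.rank_shift_glue hx hx0 k
  bounded _ hx := h.bounded_glue hx
  gap _ hx := h.gap_glue hx
  eventually_lt _ hx hx0 := h.eventually_lt_glue hx hx0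
  recurrent _ hx hx0 _ hγ _ hU d := h.recurrent_glue hx hx0 hγ hU d

end IsGlueable

/-! ### Existence of ranked sets for all countable ordinals. -/

theorem countable_Iic_of_lt_omega_one {β : Ordinal.{0}} (hβ : β < Ordinal.omega 1) :
    (Iic β).Countable := by
  have hs : β + 1 < Ordinal.omega 1 := by
    rw [← Cardinal.ord_aleph] at hβ ⊢
    exact (Cardinal.isSuccLimit_ord (Cardinal.aleph0_le_aleph 1)).add_one_lt hβ
  rw [← Cardinal.ord_aleph, Cardinal.lt_ord, ← Cardinal.succ_aleph0, Order.lt_succ_iff] at hs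
  have hI : Iic β = Iio (β + 1) := by
    ext x
    rw [mem_Iic, mem_Iio, Order.lt_add_one_iff]
  rw [hI, ← Cardinal.le_aleph0_iff_set_countable, Cardinal.mk_Iio_ordinal, Cardinal.lift_le_aleph0]
  exact hs

/-- The induction must hold for every `N` at once, since the pieces need gaps that grow with their
index. -/
theorem exists_isRanked {β : Ordinal.{0}} (hβ : β < Ordinal.omega 1) (N : ℕ) :
    ∃ Y r, IsRanked β N Y r := by
  induction β using WellFoundedLT.induction generalizing N with
  | ind β ih =>
    obtain ⟨f, hf⟩ := (countable_Iic_of_lt_omega_one hβ).exists_eq_range ⟨β, mem_Iic.2 le_rfl⟩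
    -- Unpairing the index makes every ordinal at most `β` occur infinitely often. Indices with
    -- value `β` get a dummy set, which `glue` ignores.
    have hex : ∀ i : ℕ, ∃ Y r, f i.unpair.1 < β →
        IsRanked (f i.unpair.1) ((i + 1 + 1) * (N + 1 + i)) Y r := by
      intro i
      by_cases hi : f i.unpair.1 < β
      · obtain ⟨Y, r, h⟩ := ih _ hi (hi.trans hβ) ((i + 1 + 1) * (N + 1 + i))
        exact ⟨Y, r, fun _ => h⟩
      · exact ⟨∅, 0, fun h => absurd h hi⟩
    choose Z r hZ using hex
    refine ⟨_, _, IsGlueable.isRanked (b := fun i => f i.unpair.1) (Z := Z) (r := r) ⟨hZ, ?_⟩⟩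
    intro γ hγ M
    have hγ' : γ ∈ Iic β := hγ.le
    rw [hf] at hγ'
    obtain ⟨c, rfl⟩ := hγ'
    exact ⟨Nat.pair c M, Nat.right_le_pair c M, by simp⟩

end BiSeq

/-! ### Essential expansiveness from a symbolic factor. -/

namespace BiSeq

theorem zpow_semiconj {X : Type} [TopologicalSpace X] {T : X ≃ₜ X} {p : X → ℤ → Bool}
    (hT : ∀ x, p (T x) = shift 1 (p x)) (k : ℤ) (x : X) : p ((T ^ k : X ≃ₜ X) x) = shift k (p x) := by
  have hinv : ∀ x, p (T⁻¹ x) = shift (-1) (p x) := by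
    intro x
    have h : p x = shift 1 (p (T⁻¹ x)) := by
      rw [← hT]
      exact congrArg p (T.apply_symm_apply x).symm
    rw [h, shift_shift, neg_add_cancel, shift_zero_left]
  induction k generalizing x with
  | zero => simp
  | succ k ih =>
    rw [zpow_add_one, Homeomorph.mul_apply, ih, hT, shift_shift]
  | pred k ih =>
    rw [zpow_sub_one, Homeomorph.mul_apply, ih, hinv, shift_shift, sub_eq_add_neg]

/-- The set is compact, as the image of a closed set of pairs, and discrete, since a base point with
several preimages is isolated in the range. -/
theorem finite_setOf_large_fiber {X : Type} [MetricSpace X] [CompactSpace X] {p : X → ℤ → Bool}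
    (hp : Continuous p)
    (hiso : ∀ x x', p x = p x' → x ≠ x' → ∀ᶠ y in 𝓝 (p x), y ∈ range p → y = p x)
    {δ : ℝ} (hδ : 0 < δ) : {y | ∃ x x', p x = y ∧ p x' = y ∧ δ ≤ dist x x'}.Finite := by
  have hcl : IsClosed {q : X × X | p q.1 = p q.2 ∧ δ ≤ dist q.1 q.2} :=
    (isClosed_eq (hp.comp continuous_fst) (hp.comp continuous_snd)).inter
      (isClosed_le continuous_const continuous_dist)
  have him : {y | ∃ x x', p x = y ∧ p x' = y ∧ δ ≤ dist x x'} =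
      (fun q : X × X => p q.1) '' {q : X × X | p q.1 = p q.2 ∧ δ ≤ dist q.1 q.2} := by
    ext y
    constructor
    · rintro ⟨x, x', rfl, h, hd⟩
      exact ⟨(x, x'), ⟨h.symm, hd⟩, rfl⟩
    · rintro ⟨⟨x, x'⟩, ⟨h, hd⟩, rfl⟩
      exact ⟨x, x', rfl, h.symm, hd⟩
  have hcomp : IsCompact {y | ∃ x x', p x = y ∧ p x' = y ∧ δ ≤ dist x x'} := by
    rw [him]
    exact hcl.isCompact.image (hp.comp continuous_fst)
  refine hcomp.finite (IsDiscrete.of_nhdsWithin ?_)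
  rintro y ⟨x, x', rfl, h, hd⟩
  have hne : x ≠ x' := by
    rintro rfl
    rw [dist_self] at hd
    exact absurd hδ (not_lt.2 hd)
  rw [Filter.le_pure_iff, mem_nhdsWithin_iff_eventually]
  filter_upwards [hiso x x' h.symm hne] with z hz hz'
  obtain ⟨w, -, hw, -⟩ := hz'
  exact hz ⟨w, hw⟩

theorem isEssentiallyNExpansive_of_factor {X : Type} [MetricSpace X] [CompactSpace X] (T : X ≃ₜ X)
    {p : X → ℤ → Bool} (hp : Continuous p) (hT : ∀ x, p (T x) = shift 1 (p x)) {n : ℕ}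
    (hcard : ∀ y, (p ⁻¹' {y}).encard ≤ n)
    (hiso : ∀ x x', p x = p x' → x ≠ x' → ∀ᶠ y in 𝓝 (p x), y ∈ range p → y = p x)
    (horb : ∀ F : Set (ℤ → Bool), F.Finite → (∀ y ∈ F, ∃ x x', p x = y ∧ p x' = y ∧ x ≠ x') →
      ∃ x, (p ⁻¹' {p x}).encard = n ∧ ∀ k, shift k (p x) ∉ F) :
    IsEssentiallyNExpansive T n := by
  -- The zeroth symbol is read as a real number, so that values less than `1` apart coincide; small
  -- dynamical balls then lie in fibres of `p`.
  have hu : UniformContinuous fun x => if p x 0 = true then (1 : ℝ) else 0 :=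
    CompactSpace.uniformContinuous_of_continuous
      ((continuous_of_discreteTopology (f := fun c : Bool => if c = true then (1 : ℝ) else 0)).comp
        ((continuous_apply_bool 0).comp hp))
  obtain ⟨ε, hε, hclose⟩ := Metric.uniformContinuous_iff.1 hu 1 one_pos
  have hsub : ∀ δ ≤ ε / 2, ∀ x, dynBall T δ x ⊆ p ⁻¹' {p x} := by
    intro δ hδ x y hy
    rw [mem_preimage, mem_singleton_iff]
    funext k
    have h1 := hclose ((hy k).trans_lt (hδ.trans_lt (half_lt_self hε)))
    have h2 : p ((T ^ k : X ≃ₜ X) x) 0 = p ((T ^ k : X ≃ₜ X) y) 0 := by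
      by_contra hne
      revert h1
      generalize p ((T ^ k : X ≃ₜ X) x) 0 = u at hne
      generalize p ((T ^ k : X ≃ₜ X) y) 0 = v at hne
      cases u <;> cases v <;> simp at hne ⊢
    rw [zpow_semiconj hT, zpow_semiconj hT] at h2
    simpa [shift] using h2.symm
  refine ⟨⟨ε / 2, half_pos hε, fun x => (encard_le_encard (hsub _ le_rfl x)).trans (hcard _)⟩,
    ε / 2, half_pos hε, fun δ hδ hle => ?_⟩
  obtain ⟨x, hx, hF⟩ := horb _ (finite_setOf_large_fiber hp hiso hδ) (by
    rintro y ⟨x, x', h1, h2, hd⟩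
    refine ⟨x, x', h1, h2, ?_⟩
    rintro rfl
    rw [dist_self] at hd
    exact absurd hδ (not_lt.2 hd))
  refine ⟨x, ?_⟩
  rw [← hx]
  congr 1
  refine Subset.antisymm (hsub δ hle x) fun y hy k => ?_
  by_contra! hlt
  refine hF k ⟨_, _, zpow_semiconj hT k x, ?_, hlt.le⟩
  rw [zpow_semiconj hT, show p y = p x from hy]

/-! ### Splitting the points of rank zero. -/

/-- The nonzero points of rank zero. -/
def bottom (Y : Set (ℤ → Bool)) (r : (ℤ → Bool) → Ordinal.{0}) : Set (ℤ → Bool) :=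
  {y | y ∈ Y ∧ y ≠ zero ∧ r y = 0}

/-- The set `Y` with every point of `bottom Y r` replaced by `n` points. -/
def fan (Y : Set (ℤ → Bool)) (r : (ℤ → Bool) → Ordinal.{0}) (n : ℕ) [NeZero n] :
    Set ((ℤ → Bool) × (bottom Y r → Fin n)) :=
  {x | x.1 ∈ Y ∧ ∀ z, x.2 z ≠ 0 → x.1 = z}

/-- The rank with the value `β + 1` at the zero sequence. -/
noncomputable def topRank (β : Ordinal.{0}) (r : (ℤ → Bool) → Ordinal.{0}) (x : ℤ → Bool) :
    Ordinal.{0} :=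
  open Classical in if x = zero then β + 1 else r x

theorem topRank_zero (β : Ordinal.{0}) (r : (ℤ → Bool) → Ordinal.{0}) :
    topRank β r zero = β + 1 := if_pos rfl

theorem topRank_of_ne {β : Ordinal.{0}} {r : (ℤ → Bool) → Ordinal.{0}} {x : ℤ → Bool}
    (hx : x ≠ zero) : topRank β r x = r x := if_neg hx

namespace IsRanked

variable {β : Ordinal.{0}} {N : ℕ} {Y : Set (ℤ → Bool)} {r : (ℤ → Bool) → Ordinal.{0}}

theorem mem_bottom_iff {x : ℤ → Bool} (hx : x ∈ Y) : x ∈ bottom Y r ↔ topRank β r x = 0 := by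
  by_cases h0 : x = zero
  · subst h0
    rw [topRank_zero]
    exact iff_of_false (fun h => h.2.1 rfl) (by simp)
  · rw [topRank_of_ne h0]
    exact ⟨fun h => h.2.2, fun h => ⟨hx, h0, h⟩⟩

theorem topRank_lt (h : IsRanked β N Y r) {x : ℤ → Bool} (hx : x ∈ Y) (hx0 : x ≠ zero) :
    topRank β r x < β + 1 := by
  rw [topRank_of_ne hx0]
  exact (h.rank_le x hx hx0).trans_lt (lt_add_one β)

theorem eventually_topRank_lt (h : IsRanked β N Y r) {x : ℤ → Bool} (hx : x ∈ Y) :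
    ∀ᶠ y in 𝓝 x, y ∈ Y → y ≠ x → topRank β r y < topRank β r x := by
  by_cases h0 : x = zero
  · subst h0
    refine Filter.Eventually.of_forall fun y hy hne => ?_
    rw [topRank_zero]
    exact h.topRank_lt hy hne
  · filter_upwards [h.eventually_lt x hx h0, eventually_ne h0] with y h1 h2 hy hne
    rw [topRank_of_ne h0, topRank_of_ne h2]
    exact h1 hy hne

theorem recurrent_topRank (h : IsRanked β N Y r) {x : ℤ → Bool} (hx : x ∈ Y) {γ : Ordinal.{0}}
    (hγ : γ < topRank β r x) {U : Set (ℤ → Bool)} (hU : U ∈ 𝓝 x) (d : ℕ) :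
    ∃ k : ℕ, 1 ≤ k ∧ ∃ z ∈ Y, z ≠ zero ∧ γ ≤ r z ∧
      ∀ j ≤ d, shift ((j * k : ℕ) : ℤ) z ∈ U := by
  by_cases h0 : x = zero
  · subst h0
    rw [topRank_zero, Order.lt_add_one_iff] at hγ
    obtain ⟨M, hM⟩ := exists_cylinder_subset hU
    -- This spike is just left of the window `[-M, M]`, and shifting moves it further left.
    refine ⟨1, le_rfl, spike (-(M + 1 : ℤ)), h.spike_mem _, spike_ne_zero _,
      by rwa [h.rank_spike], fun j _ => hM _ fun n hn => ?_⟩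
    simp only [shift_spike, spike, zero, decide_eq_false_iff_not]
    omega
  · rw [topRank_of_ne h0] at hγ
    exact h.recurrent x hx h0 γ hγ U hU d

theorem aperiodic (h : IsRanked β N Y r) {x : ℤ → Bool} (hx : x ∈ Y) (hx0 : x ≠ zero) {k : ℕ}
    (hk : 1 ≤ k) : shift k x ≠ x := by
  intro he
  obtain ⟨M, hM⟩ := h.bounded x hx
  obtain ⟨a, ha, hmax⟩ := Int.exists_greatest_of_bdd (P := fun n => x n = true)
    ⟨M, fun n hn => by have := hM n hn; omega⟩ (ne_zero_iff.1 hx0)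
  have h1 : x (a + k) = true := by
    rw [← ha]
    exact congrFun he a
  have := hmax _ h1
  omega

theorem countable (h : IsRanked β N Y r) : Y.Countable :=
  countable_of_bounded.mono fun x hx => h.bounded x hx

theorem shift_mem_bottom (h : IsRanked β N Y r) {x : ℤ → Bool} (hx : x ∈ bottom Y r) (k : ℤ) :
    shift k x ∈ bottom Y r :=
  ⟨h.shift_mem x hx.1 k, IsGlueable.shift_ne_zero hx.2.1 k,
    (h.rank_shift x hx.1 hx.2.1 k).trans hx.2.2⟩

section Fan

variable {n : ℕ} [NeZero n]

theorem isClosed_fan (h : IsRanked β N Y r) : IsClosed (fan Y r n) := by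
  refine (h.isClosed.preimage continuous_fst).inter ?_
  have : {x : (ℤ → Bool) × (bottom Y r → Fin n) | ∀ z, x.2 z ≠ 0 → x.1 = z} =
      ⋂ z : bottom Y r, {x | x.2 z ≠ 0 → x.1 = (z : ℤ → Bool)} := by
    ext x
    simp only [mem_iInter, mem_ofPred_eq]
  change IsClosed {x : (ℤ → Bool) × (bottom Y r → Fin n) | ∀ z, x.2 z ≠ 0 → x.1 = z}
  rw [this]
  refine isClosed_iInter fun z => isClosed_imp ?_ (isClosed_eq continuous_fst continuous_const)
  have hz : Continuous fun x : (ℤ → Bool) × (bottom Y r → Fin n) => x.2 z :=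
    (continuous_apply z).comp continuous_snd
  exact (isOpen_discrete {i : Fin n | i ≠ 0}).preimage hz

/-- The action of the `k`-th power of the shift on the fan. -/
def act (h : IsRanked β N Y r) (k : ℤ) (x : fan Y r n) : fan Y r n :=
  ⟨(shift k x.1.1, fun z => x.1.2 ⟨shift (-k) z, h.shift_mem_bottom z.2 _⟩),
    h.shift_mem _ x.2.1 k, fun z hz => by
      dsimp only
      rw [x.2.2 _ hz, shift_shift, add_neg_cancel, shift_zero_left]⟩

theorem act_act (h : IsRanked β N Y r) (j k : ℤ) (x : fan Y r n) :
    h.act j (h.act k x) = h.act (j + k) x := by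
  refine Subtype.ext (Prod.ext (shift_shift _ _ _) ?_)
  funext z
  simp only [act, shift_shift, neg_add_rev]

theorem act_zero (h : IsRanked β N Y r) (x : fan Y r n) : h.act 0 x = x := by
  refine Subtype.ext (Prod.ext (shift_zero_left _) ?_)
  funext z
  simp only [act, neg_zero, shift_zero_left]

theorem continuous_act (h : IsRanked β N Y r) (k : ℤ) :
    Continuous (h.act k : fan Y r n → fan Y r n) := by
  refine Continuous.subtype_mk (Continuous.prodMk ?_ ?_) _
  · exact (continuous_shift k).comp (continuous_fst.comp continuous_subtype_val)
  · exact continuous_pi fun z =>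
      (continuous_apply _).comp (continuous_snd.comp continuous_subtype_val)

/-- The homeomorphism of the fan induced by the shift. -/
def fanShift (h : IsRanked β N Y r) (n : ℕ) [NeZero n] : fan Y r n ≃ₜ fan Y r n where
  toFun := h.act 1
  invFun := h.act (-1)
  left_inv x := by rw [act_act, neg_add_cancel, act_zero]
  right_inv x := by rw [act_act, add_neg_cancel, act_zero]
  continuous_toFun := h.continuous_act 1
  continuous_invFun := h.continuous_act (-1)

theorem iterate_fanShift (h : IsRanked β N Y r) (k : ℕ) (x : fan Y r n) :
    (h.fanShift n)^[k] x = h.act k x := by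
  induction k with
  | zero => exact (h.act_zero x).symm
  | succ k ih =>
    rw [Function.iterate_succ_apply', ih]
    change h.act 1 (h.act k x) = _
    rw [act_act, add_comm]
    norm_cast

/-- The points of the fan that come from points of `Y` with label zero everywhere. -/
def sec (y : Y) : fan Y r n := ⟨(y, 0), y.2, fun _ hz => absurd rfl hz⟩

theorem continuous_sec : Continuous (sec : Y → fan Y r n) :=
  Continuous.subtype_mk (continuous_subtype_val.prodMk continuous_const) _

theorem act_sec (h : IsRanked β N Y r) (k : ℤ) (y : Y) :
    h.act k (sec y : fan Y r n) = sec ⟨shift k y, h.shift_mem y y.2 k⟩ := rfl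

theorem fan_ext {x x' : fan Y r n} (h1 : x.1.1 = x'.1.1)
    (h2 : ∀ hx : x.1.1 ∈ bottom Y r, x.1.2 ⟨_, hx⟩ = x'.1.2 ⟨_, hx⟩) : x = x' := by
  refine Subtype.ext (Prod.ext h1 ?_)
  funext z
  by_cases hz : x.1.1 = z
  · have hb : x.1.1 ∈ bottom Y r := hz ▸ z.2
    have : z = ⟨x.1.1, hb⟩ := Subtype.ext hz.symm
    rw [this]
    exact h2 hb
  · rw [not_not.1 fun hne => hz (x.2.2 z hne), not_not.1 fun hne => hz (h1.trans (x'.2.2 z hne))]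

theorem eq_of_notMem_bottom {x x' : fan Y r n} (h1 : x.1.1 = x'.1.1) (hx : x.1.1 ∉ bottom Y r) :
    x = x' := fan_ext h1 fun h => absurd h hx

theorem isDynRank (h : IsRanked β N Y r) :
    IsDynRank (h.fanShift n) (fun x => topRank β r x.1.1) (sec ⟨zero, h.zero_mem⟩) (β + 1) where
  rank_top := topRank_zero β r
  map_top := h.act_sec 1 _
  lt_top x hx := by
    refine h.topRank_lt x.2.1 fun h0 => hx (eq_of_notMem_bottom h0 ?_)
    rw [h0]
    exact fun hb => hb.2.1 rfl
  aperiodic x hx k hk he := by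
    rw [iterate_fanShift] at he
    refine h.aperiodic x.2.1 (fun h0 => hx (eq_of_notMem_bottom h0 ?_)) hk
      (congrArg (fun y : fan Y r n => y.1.1) he)
    rw [h0]
    exact fun hb => hb.2.1 rfl
  eventually_lt x := by
    rw [eventually_nhdsWithin_iff]
    have hfst : Continuous fun y : fan Y r n => y.1.1 := continuous_fst.comp continuous_subtype_val
    have h1 := hfst.continuousAt.eventually (h.eventually_topRank_lt x.2.1)
    by_cases hx : x.1.1 ∈ bottom Y r
    · have hlab : Continuous fun y : fan Y r n => y.1.2 ⟨_, hx⟩ :=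
        (continuous_apply _).comp (continuous_snd.comp continuous_subtype_val)
      -- The label at `x` is locally constant, so it separates `x` from the other copies over the
      -- same sequence.
      have h2 : ∀ᶠ y in 𝓝 x, y.1.2 ⟨_, hx⟩ = x.1.2 ⟨_, hx⟩ :=
        hlab.continuousAt.eventually_mem (by simp : {x.1.2 ⟨_, hx⟩} ∈ 𝓝 (x.1.2 ⟨_, hx⟩))
      filter_upwards [h1, h2] with y hy hl hne
      exact hy y.2.1 fun he => hne (fan_ext he.symm fun _ => hl.symm).symm
    · filter_upwards [h1] with y hy hne
      exact hy y.2.1 fun he => hne (eq_of_notMem_bottom he.symm hx).symm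
  recurrent x γ hγ U hU d := by
    -- A point with a rank below its own is not over `bottom Y r`, so it carries no label and
    -- recurrence lifts from `Y` along `sec`.
    have hx : x = sec ⟨x.1.1, x.2.1⟩ := by
      refine eq_of_notMem_bottom rfl fun hb => ?_
      rw [(mem_bottom_iff x.2.1).1 hb] at hγ
      exact absurd hγ (not_lt.2 zero_le)
    rw [hx] at hU
    have hV := (continuous_sec (r := r) (n := n)).continuousAt.preimage_mem_nhds hU
    rw [nhds_subtype_eq_comap, Filter.mem_comap] at hV
    obtain ⟨V, hV, hVU⟩ := hV
    obtain ⟨k, hk, z, hz, hz0, hr, hj⟩ := h.recurrent_topRank x.2.1 hγ hV d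
    refine ⟨k, hk, sec ⟨z, hz⟩, fun he => hz0 (congrArg (fun y : fan Y r n => y.1.1) he), ?_⟩
    intro j hjd
    rw [iterate_fanShift, act_sec]
    refine ⟨hVU (hj j hjd), ?_⟩
    change γ ≤ topRank β r (shift _ z)
    rwa [topRank_of_ne (IsGlueable.shift_ne_zero hz0 _), h.rank_shift z hz hz0]

theorem encard_fiber_of_mem_bottom {y : ℤ → Bool} (hy : y ∈ bottom Y r) :
    ((fun x : fan Y r n => x.1.1) ⁻¹' {y}).encard = n := by
  classical
  let f : Fin n → fan Y r n := fun i =>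
    ⟨(y, fun z => if y = z then i else 0), hy.1, fun z hz => by
      by_contra hne
      exact hz (if_neg hne)⟩
  have hf : ((fun x : fan Y r n => x.1.1) ⁻¹' {y}) = range f := by
    ext x
    constructor
    · rintro rfl
      exact ⟨x.1.2 ⟨_, hy⟩, fan_ext rfl fun _ => if_pos rfl⟩
    · rintro ⟨i, rfl⟩
      rfl
  have hinj : Function.Injective f := by
    intro i j hij
    have := congrArg (fun x : fan Y r n => x.1.2 ⟨y, hy⟩) hij
    simpa [f] using this
  rw [hf, ← image_univ, hinj.encard_image, encard_univ]
  simp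

theorem encard_fiber_le (y : ℤ → Bool) :
    ((fun x : fan Y r n => x.1.1) ⁻¹' {y}).encard ≤ n := by
  by_cases hy : y ∈ bottom Y r
  · exact (encard_fiber_of_mem_bottom hy).le
  · refine (encard_le_one_iff.2 ?_).trans ?_
    · rintro a b rfl hb
      exact eq_of_notMem_bottom (Eq.symm hb) hy
    · exact_mod_cast NeZero.one_le

theorem countable_fan (h : IsRanked β N Y r) : Countable (fan Y r n) := by
  rw [← countable_univ_iff]
  refine (h.countable.biUnion fun y _ => (finite_of_encard_le_coe
    (encard_fiber_le (Y := Y) (r := r) (n := n) y)).countable).mono fun x _ => ?_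
  simp only [mem_iUnion]
  exact ⟨x.1.1, x.2.1, rfl⟩

/-- Take a rank-zero point that agrees with a spike on `[-2M, 2M]`, where `M` bounds the supports in
`F`. A translate in `F` must be by at most `M`, so its whole support comes from that window. It
would then be a spike, which has rank `β > 0`. -/
theorem exists_orbit_avoiding (h : IsRanked β N Y r) (hβ : 0 < β) {F : Set (ℤ → Bool)}
    (hF : F.Finite) (hFY : F ⊆ bottom Y r) : ∃ y ∈ bottom Y r, ∀ k, shift k y ∉ F := by
  obtain ⟨M, hM⟩ : ∃ M : ℕ, ∀ f ∈ F, ∀ n, f n = true → n.natAbs ≤ M := by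
    choose! B hB using fun f (hf : f ∈ F) => h.bounded f (hFY hf).1
    obtain ⟨M, hM⟩ := (hF.image B).bddAbove
    exact ⟨M, fun f hf n hn => (hB f hf n hn).trans (hM (mem_image_of_mem B hf))⟩
  have hU : ∀ᶠ x in 𝓝 (spike 0), ∀ n ∈ Finset.Icc (-(2 * M) : ℤ) (2 * M), x n = spike 0 n :=
    (Filter.eventually_all_finset _).2 fun n _ => eventually_apply_eq _ n
  obtain ⟨V, hVU, hV, h0⟩ := mem_nhds_iff.1 hU
  have hfst : Continuous fun y : fan Y r 1 => y.1.1 := continuous_fst.comp continuous_subtype_val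
  -- With `n = 1` the labels are trivial and the fan is a copy of `Y`, so the descent lemma becomes
  -- available for `Y`.
  obtain ⟨p, hp, hr⟩ := (h.isDynRank (n := 1)).exists_rank_eq_of_mem_nhds (γ := 0)
    (x := sec ⟨spike 0, h.spike_mem 0⟩) zero_le (hV.preimage hfst) h0
  refine ⟨p.1.1, (mem_bottom_iff p.2.1).2 hr, fun k hk => ?_⟩
  have hpU : ∀ n ∈ Finset.Icc (-(2 * M) : ℤ) (2 * M), p.1.1 n = spike 0 n := hVU hp
  have h1 : shift k p.1.1 (-k) = true := by
    rw [shift, neg_add_cancel, hpU 0 (by simp), spike_apply]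
  have h2 := hM _ hk _ h1
  have hne : shift k p.1.1 ≠ spike (-k) := by
    intro he
    have h3 := (hFY hk).2.2
    rw [he, h.rank_spike] at h3
    exact hβ.ne' h3
  refine hne ?_
  funext a
  rw [Bool.eq_iff_iff, spike_apply]
  constructor
  · intro ha
    have h4 := hM _ hk _ ha
    rw [shift, hpU (a + k) (Finset.mem_Icc.2 (by omega)), spike_apply] at ha
    omega
  · rintro rfl
    exact h1

theorem eventually_eq_of_mem_bottom (h : IsRanked β N Y r) {y : ℤ → Bool} (hy : y ∈ bottom Y r) :
    ∀ᶠ z in 𝓝 y, z ∈ Y → z = y := by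
  filter_upwards [h.eventually_lt y hy.1 hy.2.1] with z hz hzY
  by_contra hne
  have := hz hzY hne
  rw [hy.2.2] at this
  exact absurd this (not_lt.2 zero_le)

end Fan

end IsRanked

end BiSeq

open BiSeq in
theorem theorem4p5 (α : Ordinal.{0}) (hα : α < Ordinal.omega 1) (hα2 : 2 ≤ α)
    (hlim : ¬ Order.IsSuccLimit α) (n : ℕ) (hn : 2 ≤ n) :
    ∃ (X : Type) (_ : MetricSpace X) (_ : CompactSpace X) (_ : Countable X) (T : X ≃ₜ X),
      HasDerivedDegree X α ∧ HasVdWDepth T α ∧ HasDepth T α ∧ IsEssentiallyNExpansive T n := by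
  have : NeZero n := ⟨by omega⟩
  obtain ⟨β, rfl⟩ : ∃ β, α = β + 1 := by
    rcases zero_or_succ_or_isSuccLimit α with rfl | ⟨β, rfl⟩ | h
    · exact absurd hα2 (by simp)
    · exact ⟨β, rfl⟩
    · exact absurd h hlim
  have hβ : 0 < β := by
    refine pos_iff_ne_zero.2 ?_
    rintro rfl
    rw [zero_add] at hα2
    exact absurd hα2 (not_le.2 (by exact_mod_cast Nat.one_lt_two))
  obtain ⟨Y, r, h⟩ := exists_isRanked ((lt_add_one β).trans hα) 0
  -- Countably many label coordinates make the product metrizable.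
  have : Countable (bottom Y r) := (h.countable.mono fun x hx => hx.1).to_subtype
  have hc : CompactSpace (fan Y r n) := isCompact_iff_compactSpace.1 h.isClosed_fan.isCompact
  have hfst : Continuous fun y : fan Y r n => y.1.1 := continuous_fst.comp continuous_subtype_val
  have hb : ∀ x x' : fan Y r n, x.1.1 = x'.1.1 → x ≠ x' → x.1.1 ∈ bottom Y r := by
    intro x x' he hne
    by_contra hx
    exact hne (IsRanked.eq_of_notMem_bottom he hx)
  have hR := h.isDynRank (n := n)
  refine ⟨fan Y r n, TopologicalSpace.metrizableSpaceMetric _, hc, h.countable_fan, h.fanShift n,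
    hR.hasDerivedDegree, hR.hasVdWDepth, hR.hasDepth, ?_⟩
  let _ := TopologicalSpace.metrizableSpaceMetric (fan Y r n)
  refine isEssentiallyNExpansive_of_factor _ hfst (fun _ => rfl) IsRanked.encard_fiber_le ?_ ?_
  · intro x x' he hne
    filter_upwards [h.eventually_eq_of_mem_bottom (hb x x' he hne)] with y hy
    rintro ⟨w, rfl⟩
    exact hy w.2.1
  · intro F hF hFb
    obtain ⟨y, hy, hk⟩ := h.exists_orbit_avoiding hβ hF (by
      intro y hy
      obtain ⟨x, x', rfl, he, hne⟩ := hFb y hy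
      exact hb x x' (Eq.symm he) hne)
    exact ⟨IsRanked.sec ⟨y, hy.1⟩, IsRanked.encard_fiber_of_mem_bottom hy, hk⟩
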